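/- Let $S\in\mathbb N$, let $\Omega=\bigoplus_{k=1}^S\begin{pmatrix}0&1\\-1&0\end{pmatrix}$ in the phase-space coordinates $(q_1,p_1,\dots,q_S,p_S)$, and call a real symmetric $2S\times 2S$ matrix $\Gamma$ with $\Gamma+i\Omega\ge 0$ a quantum covariance matrix (CM). Call a real $2S\times2S$ matrix $W$ orthogonal symplectic (OS) if $W^TW=I$ and $W^T\Omega W=\Omega$. For a list of real numbers $\Lambda=(\lambda_1,\dots,\lambda_{2S})$ let $G(\Lambda)$ be the graph with vertices $1,\dots,2S$ in which $i\ne j$ are joined by an edge if and only if $\lambda_i\lambda_j\ge 1$; an edge $\{i,j\}$ is pure if $\lambda_i\lambda_j=1$. $\Lambda$ satisfies the $(S-1)$-pure unique pairing condition if $G(\Lambda)$ has a perfect matching $M$ such that every perfect matching of $G(\Lambda)$ is the image $\sigma(M)$ of $M$ under some permutation $\sigma$ of the vertices with $\lambda_{\sigma(i)}=\lambda_i$ for all $i$, and at least $S-1$ of the edges of $M$ are pure. Real numbers $\nu_1,\dots,\nu_S>0$ and $r_1,\dots,r_S$ are called thermal and squeezing parameters of $\Gamma$ if $\Gamma=ATA^T$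 with $A=KQL$, where $K,L$ are OS, $T=\mathrm{diag}(\nu_1,\nu_1,\dots,\nu_S,\nu_S)$ and $Q=\mathrm{diag}(e^{r_1},e^{-r_1},\dots,e^{r_S},e^{-r_S})$. Theorem. Suppose $\Lambda$ satisfies the $(S-1)$-pure unique pairing condition. (1) If $\Gamma$ and $\Gamma'$ are quantum CMs that both have the eigenspectrum $\Lambda$ (eigenvalues with multiplicity), then $\Gamma'=W^T\Gamma W$ for some OS matrix $W$. (2) Consequently all quantum CMs with eigenspectrum $\Lambda$ have the same thermal and squeezing parameters: there are $\nu_k\ge1$ and $r_k\ge0$ $(1\le k\le S)$ that are thermal and squeezing parameters of every quantum CM $\Gamma$ with eigenspectrum $\Lambda$, and whenever $\nu'_k$, $r'_k$ are thermal and squeezing parameters of such a $\Gamma$, the multisets $\{\nu'_k\}$ and $\{\nu_k\}$ coincide and the multisets $\{|r'_k|\}$ and $\{r_k\}$ coincide. -/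

import Mathlib

open scoped ComplexOrder

/-- Square real matrices on the phase space of `S` modes, with the coordinates listed as
`(q₁, …, q_S, p₁, …, p_S)`: `Sum.inl k` is `q_k` and `Sum.inr k` is `p_k`. -/
abbrev PhaseMatrix (S : ℕ) : Type := Matrix (Fin S ⊕ Fin S) (Fin S ⊕ Fin S) ℝ

/-- The symplectic form: `Ω (q_k, p_k) = 1 = -Ω (p_k, q_k)`, all other entries `0`. It is the
negative of Mathlib's `Matrix.J (Fin S) ℝ`, so both have the same symplectic group. -/
def symplForm (S : ℕ) : PhaseMatrix S := Matrix.fromBlocks 0 1 (-1) 0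

/-- A quantum covariance matrix: real symmetric with `Γ + iΩ ≥ 0`. -/
def IsQuantumCM {S : ℕ} (Γ : PhaseMatrix S) : Prop :=
  Γ.IsSymm ∧
    (Γ.map (fun x : ℝ => (x : ℂ)) +
      Complex.I • (symplForm S).map (fun x : ℝ => (x : ℂ))).PosSemidef

/-- `W` is orthogonal symplectic (OS). -/
def IsOS {S : ℕ} (W : PhaseMatrix S) : Prop :=
  W ∈ Matrix.symplecticGroup (Fin S) ℝ ∧ W ∈ Matrix.orthogonalGroup (Fin S ⊕ Fin S) ℝ

/-- `Γ'` is an OS transform of `Γ`. -/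
def IsOSTransform {S : ℕ} (Γ Γ' : PhaseMatrix S) : Prop :=
  ∃ W : PhaseMatrix S, IsOS W ∧ Γ' = W.transpose * Γ * W

/-- `Λ` lists the eigenvalues of `Γ` with multiplicity (in any order). -/
def HasEigenspectrum {S : ℕ} (Γ : PhaseMatrix S) (Λ : Fin (2 * S) → ℝ) : Prop :=
  Γ.charpoly.roots = Finset.univ.val.map Λ

/-- The graph `G(Λ)`: distinct `i`, `j` are joined when `λ_i λ_j ≥ 1`. -/
def pairingGraph {n : ℕ} (Λ : Fin n → ℝ) : SimpleGraph (Fin n) where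
  Adj i j := i ≠ j ∧ 1 ≤ Λ i * Λ j
  symm := ⟨fun i j h => ⟨h.1.symm, by rw [mul_comm]; exact h.2⟩⟩
  loopless := ⟨fun _ h => h.1 rfl⟩

/-- Two matchings agree up to permuting vertices that carry equal eigenvalues. -/
def SameUpToDegeneracy {n : ℕ} (Λ : Fin n → ℝ) (M M' : (pairingGraph Λ).Subgraph) : Prop :=
  ∃ σ : Equiv.Perm (Fin n), (∀ i, Λ (σ i) = Λ i) ∧ M'.edgeSet = Sym2.map σ '' M.edgeSet

/-- The pure edges of a matching: the edges `{i, j}` with `λ_i λ_j = 1`. -/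
def pureEdges {n : ℕ} (Λ : Fin n → ℝ) (M : (pairingGraph Λ).Subgraph) : Set (Sym2 (Fin n)) :=
  {e | e ∈ M.edgeSet ∧ ∃ i j, e = s(i, j) ∧ Λ i * Λ j = 1}

/-- The `t`-pure unique pairing condition: `G(Λ)` has a perfect matching, unique up to permuting
vertices with equal eigenvalues, and at least `t` of its edges are pure. -/
def PureUniquePairing {n : ℕ} (t : ℕ) (Λ : Fin n → ℝ) : Prop :=
  ∃ M : (pairingGraph Λ).Subgraph, M.IsPerfectMatching ∧
    (∀ M' : (pairingGraph Λ).Subgraph, M'.IsPerfectMatching → SameUpToDegeneracy Λ M M') ∧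
    t ≤ (pureEdges Λ M).ncard

/-- `diag(ν₁, …, ν_S, ν₁, …, ν_S)`. -/
def thermalMatrix {S : ℕ} (ν : Fin S → ℝ) : PhaseMatrix S :=
  Matrix.diagonal (Sum.elim ν ν)

/-- `diag(e^{r₁}, …, e^{r_S}, e^{-r₁}, …, e^{-r_S})`. -/
noncomputable def squeezingMatrix {S : ℕ} (r : Fin S → ℝ) : PhaseMatrix S :=
  Matrix.diagonal (Sum.elim (fun k => Real.exp (r k)) (fun k => Real.exp (-r k)))

/-- `ν` are thermal parameters and `r` are squeezing parameters of `Γ`: `Γ = A T Aᵀ` with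
`A = K Q L`, where `K`, `L` are OS. -/
def HasParameters {S : ℕ} (Γ : PhaseMatrix S) (ν r : Fin S → ℝ) : Prop :=
  (∀ k, 0 < ν k) ∧
    ∃ K L : PhaseMatrix S, IsOS K ∧ IsOS L ∧
      Γ = (K * squeezingMatrix r * L) * thermalMatrix ν * (K * squeezingMatrix r * L).transpose

/-!
A quantum covariance matrix is a symmetric operator `T` on a Euclidean space with complex
structure `J = -Ω` such that `2 ⟪J x, y⟫ ≤ ⟪T x, x⟫ + ⟪T y, y⟫` for all `x`, `y`. The idea is to
find directions in which this uncertainty relation is saturated. If the number of eigenvalues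
above `a` and the number of those above `a⁻¹`, with multiplicity, add up to less than `dim E`,
then some unit vector `x` lies in the spectral subspace of `T` for `(-∞, a]` while `J x` lies in
that for `(-∞, a⁻¹]`. The uncertainty relation forces `⟪T x, x⟫ = a` and `⟪T (J x), J x⟫ = a⁻¹`,
so `x` and `J x` are eigenvectors with eigenvalues `a` and `a⁻¹` (`exists_pure_eigenvector`). The
orthogonal complement of the plane they span is invariant under `T` and `J`, so one pure pair
after another can be split off until a single mode is left, which any eigenvector diagonalizes
(`exists_unitary_eigenframe`).

The dimension count needs that, for each pure pair `(a, a⁻¹)` with `a ≥ 1`, the one possibly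
impure pair `c ≥ d` satisfies `c ≤ a` or `d ≤ a⁻¹`. This is what unique pairing provides:
otherwise `c a⁻¹ > 1` and `a d > 1`, so exchanging partners gives a perfect matching with fewer
pure edges, which cannot be obtained from the first one by permuting equal eigenvalues
(`nested_of_unique`).

Hence every covariance matrix with the given spectrum is an orthogonal symplectic transform of the
same diagonal matrix. This gives the transform between any two of them, and the parameters. That
the parameters are determined by the matrix (`HasParameters.unique`) is the uniqueness part of
Williamson's theorem: a symplectic matrix carrying one thermal matrix to another by congruence is
orthogonal, so the matrix `A Aᵀ`, whose spectrum is `exp (± 2 r)`, depends only on `A T Aᵀ`.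
-/

/-! ### Unitary eigenframes from the uncertainty relation -/

section NormalForm

open Module
open scoped InnerProductSpace

variable {E : Type*} [NormedAddCommGroup E] [InnerProductSpace ℝ E]

/-- An orthogonal complex structure on a real inner product space. -/
structure IsComplexStructure (J : E →ₗ[ℝ] E) : Prop where
  inner_map_map : ∀ x y, ⟪J x, J y⟫_ℝ = ⟪x, y⟫_ℝ
  map_map : ∀ x, J (J x) = -x

/-- The uncertainty relation `T + iΩ ≥ 0`, with `Ω = -J`, as an inequality between real vectors. -/
def SatisfiesUncertainty (T J : E →ₗ[ℝ] E) : Prop :=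
  ∀ x y, 2 * ⟪J x, y⟫_ℝ ≤ ⟪T x, x⟫_ℝ + ⟪T y, y⟫_ℝ

theorem IsComplexStructure.inner_self_map {J : E →ₗ[ℝ] E} (hJ : IsComplexStructure J) (x : E) :
    ⟪x, J x⟫_ℝ = 0 := by
  have h := hJ.inner_map_map x (J x)
  rw [hJ.map_map, inner_neg_right, real_inner_comm] at h
  linarith

theorem IsComplexStructure.inner_map_left {J : E →ₗ[ℝ] E} (hJ : IsComplexStructure J) (x y : E) :
    ⟪J x, y⟫_ℝ = -⟪x, J y⟫_ℝ := by
  rw [← hJ.inner_map_map (J x) y, hJ.map_map, inner_neg_left]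

theorem IsComplexStructure.norm_map {J : E →ₗ[ℝ] E} (hJ : IsComplexStructure J) (x : E) :
    ‖J x‖ = ‖x‖ := by
  rw [norm_eq_sqrt_real_inner, norm_eq_sqrt_real_inner, hJ.inner_map_map]

theorem roots_charpoly_of_eigenbasis {K V ι : Type*} [Field K] [AddCommGroup V] [Module K V]
    [Module.Finite K V] [Fintype ι] (b : Basis ι K V) {T : V →ₗ[K] V} {μ : ι → K}
    (h : ∀ i, T (b i) = μ i • b i) :
    T.charpoly.roots = Finset.univ.val.map μ := by
  classical
  have hM : LinearMap.toMatrix b b T = Matrix.diagonal μ := by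
    ext i j
    rw [LinearMap.toMatrix_apply, h, map_smul, Finsupp.smul_apply, b.repr_self,
      Matrix.diagonal_apply]
    by_cases hij : i = j
    · subst hij; simp
    · simp [hij]
  rw [← LinearMap.charpoly_toMatrix T b, hM, Matrix.charpoly_diagonal]
  rw [← Polynomial.roots_multiset_prod_X_sub_C (Finset.univ.val.map μ), Multiset.map_map]
  rfl

/-- On the span of the eigenvectors with eigenvalue at most `a`, the quadratic form of `T` is at
most `a‖x‖²`, and equality forces an eigenvector. -/
theorem eigenvector_of_inner_eq {ι : Type*} [Fintype ι] {T : E →ₗ[ℝ] E} (hT : T.IsSymmetric)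
    (e : OrthonormalBasis ι ℝ E) {μ : ι → ℝ} (he : ∀ i, T (e i) = μ i • e i) {a : ℝ} {x : E}
    (hx : ∀ i, a < μ i → ⟪e i, x⟫_ℝ = 0) :
    ⟪T x, x⟫_ℝ ≤ a * ‖x‖ ^ 2 ∧ (⟪T x, x⟫_ℝ = a * ‖x‖ ^ 2 → T x = a • x) := by
  have hTe : ∀ i, ⟪e i, T x⟫_ℝ = μ i * ⟪e i, x⟫_ℝ := fun i => by
    rw [← hT, he, real_inner_smul_left]
  have hsum : a * ‖x‖ ^ 2 - ⟪T x, x⟫_ℝ = ∑ i, (a - μ i) * ⟪e i, x⟫_ℝ ^ 2 := by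
    rw [← real_inner_self_eq_norm_sq, ← e.sum_inner_mul_inner x x, ← e.sum_inner_mul_inner (T x) x,
      Finset.mul_sum, ← Finset.sum_sub_distrib]
    refine Finset.sum_congr rfl fun i _ => ?_
    rw [real_inner_comm (e i) (T x), hTe, real_inner_comm (e i) x]
    ring
  have hnn : ∀ i ∈ Finset.univ, 0 ≤ (a - μ i) * ⟪e i, x⟫_ℝ ^ 2 := fun i _ => by
    rcases lt_or_ge a (μ i) with h | h
    · simp [hx i h]
    · exact mul_nonneg (by linarith) (sq_nonneg _)
  refine ⟨by linarith [Finset.sum_nonneg hnn], fun heq => ?_⟩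
  rw [heq, sub_self] at hsum
  have h0 := (Finset.sum_eq_zero_iff_of_nonneg hnn).1 hsum.symm
  refine InnerProductSpace.ext_inner_left_basis (𝕜 := ℝ) e.toBasis fun i => ?_
  rw [e.coe_toBasis, hTe, real_inner_smul_right]
  rcases mul_eq_zero.1 (h0 i (Finset.mem_univ i)) with h | h
  · rw [show μ i = a by linarith]
  · rw [pow_eq_zero_iff two_ne_zero] at h
    simp [h]

/-- If few eigenvalues exceed `a` and few exceed `a⁻¹`, a dimension count gives a unit vector `x`
on which `T` is at most `a` while `T` is at most `a⁻¹` on `J x`. The uncertainty relation is then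
saturated, so both are eigenvectors. -/
theorem exists_pure_eigenvector [FiniteDimensional ℝ E] {T J : E →ₗ[ℝ] E} (hT : T.IsSymmetric)
    (hJ : IsComplexStructure J) (hU : SatisfiesUncertainty T J) {a : ℝ} (ha : 0 < a)
    (hcount : T.charpoly.roots.countP (a < ·) + T.charpoly.roots.countP (a⁻¹ < ·) < finrank ℝ E) :
    ∃ x : E, ‖x‖ = 1 ∧ T x = a • x ∧ T (J x) = a⁻¹ • J x := by
  classical
  let e := hT.eigenvectorBasis rfl
  let μ := hT.eigenvalues rfl
  have he : ∀ i, T (e i) = μ i • e i := fun i => hT.apply_eigenvectorBasis rfl i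
  have hroots : T.charpoly.roots = Finset.univ.val.map μ :=
    roots_charpoly_of_eigenbasis e.toBasis (by simpa using he)
  have hcard : ∀ t : ℝ, T.charpoly.roots.countP (t < ·) = Fintype.card {i // t < μ i} := fun t => by
    rw [hroots, Multiset.countP_map, Fintype.card_subtype]
    rfl
  -- The coordinates of `x` above `a` and those of `J x` above `a⁻¹`.
  let f : E →ₗ[ℝ] ({i // a < μ i} ⊕ {i // a⁻¹ < μ i} → ℝ) :=
    LinearMap.pi (Sum.elim (fun i => innerₛₗ ℝ (e i)) (fun i => innerₛₗ ℝ (e i) ∘ₗ J))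
  have hker : LinearMap.ker f ≠ ⊥ := f.ker_ne_bot_of_finrank_lt (by
    rwa [finrank_fintype_fun_eq_card, Fintype.card_sum, ← hcard, ← hcard])
  obtain ⟨y, hy, hy0⟩ := Submodule.exists_mem_ne_zero_of_ne_bot hker
  have hyn : ‖y‖ ≠ 0 := norm_ne_zero_iff.2 hy0
  let x : E := ‖y‖⁻¹ • y
  have hx : f x = 0 := by simp [x, LinearMap.mem_ker.1 hy]
  have hx1 : ‖x‖ = 1 := by simp [x, norm_smul, hyn]
  obtain ⟨h1, h1'⟩ := eigenvector_of_inner_eq hT e he (a := a) (x := x)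
    fun i hi => congrFun hx (Sum.inl ⟨i, hi⟩)
  obtain ⟨h2, h2'⟩ := eigenvector_of_inner_eq hT e he (a := a⁻¹) (x := J x)
    fun i hi => congrFun hx (Sum.inr ⟨i, hi⟩)
  -- The scaling by `a` balances the two bounds, so that they sum to `2 a`.
  have h3 := hU x (a • J x)
  simp only [map_smul, real_inner_smul_left, real_inner_smul_right, hJ.inner_map_map,
    real_inner_self_eq_norm_sq, hJ.norm_map, hx1] at h1 h2 h1' h2' h3
  have h4 : a * (a * ⟪T (J x), J x⟫_ℝ) ≤ a := by
    have := mul_le_mul_of_nonneg_left h2 (mul_pos ha ha).le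
    field_simp at this
    nlinarith
  refine ⟨x, hx1, h1' (by linarith), h2' (le_antisymm h2 ?_)⟩
  have h5 : a ≤ a * (a * ⟪T (J x), J x⟫_ℝ) := by linarith
  have h6 : 1 ≤ a * ⟪T (J x), J x⟫_ℝ := le_of_mul_le_mul_left (by simpa using h5) ha
  rw [one_pow, mul_one]
  exact (inv_le_iff_one_le_mul₀' ha).2 h6

theorem orthonormal_sumElim_pair {ι : Type*} {x y : E} (hx : ‖x‖ = 1) (hy : ‖y‖ = 1)
    (hxy : ⟪x, y⟫_ℝ = 0) {f : ι → (Submodule.span ℝ {x, y})ᗮ} (hf : Orthonormal ℝ f) :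
    Orthonormal ℝ (Sum.elim ![x, y] (fun i => (f i : E))) := by
  have hfx : ∀ i, ⟪x, (f i : E)⟫_ℝ = 0 := fun i =>
    Submodule.inner_right_of_mem_orthogonal (Submodule.subset_span (by simp)) (f i).2
  have hfy : ∀ i, ⟪y, (f i : E)⟫_ℝ = 0 := fun i =>
    Submodule.inner_right_of_mem_orthogonal (Submodule.subset_span (by simp)) (f i).2
  classical
  rw [orthonormal_iff_ite] at hf ⊢
  have hyx : ⟪y, x⟫_ℝ = 0 := by rw [real_inner_comm, hxy]
  have hff : ∀ i j, ⟪(f i : E), (f j : E)⟫_ℝ = if i = j then 1 else 0 := hf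
  rintro (i | i) (j | j)
  · fin_cases i <;> fin_cases j <;> simp [hxy, hyx, hx, hy]
  · fin_cases i <;> simp [hfx, hfy]
  · fin_cases j <;> simp [hfx, hfy, real_inner_comm]
  · simp [hff]

theorem finrank_orthogonal_pair [FiniteDimensional ℝ E] {x y : E} (hx : ‖x‖ = 1) (hy : ‖y‖ = 1)
    (hxy : ⟪x, y⟫_ℝ = 0) : 2 + finrank ℝ (Submodule.span ℝ {x, y})ᗮ = finrank ℝ E := by
  have hon : Orthonormal ℝ ![x, y] := by
    classical
    rw [orthonormal_iff_ite]
    have hyx : ⟪y, x⟫_ℝ = 0 := by rw [real_inner_comm, hxy]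
    intro i j
    fin_cases i <;> fin_cases j <;> simp [hxy, hyx, hx, hy]
  have h := finrank_span_eq_card hon.linearIndependent
  rw [Matrix.range_cons_cons_empty, Fintype.card_fin] at h
  rw [← Submodule.finrank_add_finrank_orthogonal (Submodule.span ℝ {x, y}), h]

theorem roots_charpoly_eq_cons_cons [FiniteDimensional ℝ E] {T : E →ₗ[ℝ] E} (hT : T.IsSymmetric)
    {x y : E} (hx : ‖x‖ = 1) (hy : ‖y‖ = 1) (hxy : ⟪x, y⟫_ℝ = 0) {a b : ℝ} (hTx : T x = a • x)
    (hTy : T y = b • y) (hW : ∀ w ∈ (Submodule.span ℝ {x, y})ᗮ, T w ∈ (Submodule.span ℝ {x, y})ᗮ) :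
    T.charpoly.roots = {a, b} + (T.restrict hW).charpoly.roots := by
  have hTW := hT.restrict_invariant hW
  let f := hTW.eigenvectorBasis rfl
  have hf : ∀ i, T (f i) = hTW.eigenvalues rfl i • (f i : E) := fun i =>
    congrArg Subtype.val (hTW.apply_eigenvectorBasis rfl i)
  have hon := orthonormal_sumElim_pair hx hy hxy f.orthonormal
  have hcard : Fintype.card (Fin 2 ⊕ Fin (finrank ℝ (Submodule.span ℝ {x, y})ᗮ)) = finrank ℝ E := by
    simpa using finrank_orthogonal_pair hx hy hxy
  rw [roots_charpoly_of_eigenbasis (basisOfOrthonormalOfCardEqFinrank hon hcard)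
    (μ := Sum.elim ![a, b] (hTW.eigenvalues rfl)), roots_charpoly_of_eigenbasis f.toBasis
    (μ := hTW.eigenvalues rfl)]
  · simp [← Finset.univ_disjSum_univ, Finset.disjSum, Multiset.disjSum]
  · intro i
    rw [OrthonormalBasis.coe_toBasis]
    exact hTW.apply_eigenvectorBasis rfl i
  · rw [coe_basisOfOrthonormalOfCardEqFinrank]
    rintro (i | i)
    · fin_cases i
      · exact hTx
      · exact hTy
    · exact hf i

/-- Eigenvalues of `n + 1` modes, arranged in pairs `α k ≥ β k`, of which all but the last are
pure. No pure pair `α k`, `β k = (α k)⁻¹` is strictly exceeded by the last pair in both members. -/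
structure IsNestedPairing {n : ℕ} (α β : Fin (n + 1) → ℝ) : Prop where
  one_le : ∀ k : Fin n, 1 ≤ α k.castSucc
  pure : ∀ k : Fin n, β k.castSucc = (α k.castSucc)⁻¹
  nested : ∀ k : Fin n, α (Fin.last n) ≤ α k.castSucc ∨ β (Fin.last n) ≤ (α k.castSucc)⁻¹
  last_le : β (Fin.last n) ≤ α (Fin.last n)

theorem IsNestedPairing.tail {n : ℕ} {α β : Fin (n + 2) → ℝ} (h : IsNestedPairing α β) :
    IsNestedPairing (fun k : Fin (n + 1) => α k.succ) (fun k => β k.succ) where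
  one_le k := h.one_le k.succ
  pure k := h.pure k.succ
  nested k := h.nested k.succ
  last_le := h.last_le

/-- Each pair contributes at most `2` to the two counts, and the pair of `α 0` at most `1`. -/
theorem IsNestedPairing.countP_lt {n : ℕ} {α β : Fin (n + 2) → ℝ} (h : IsNestedPairing α β) :
    (∑ k, ({α k, β k} : Multiset ℝ)).countP (α 0 < ·) +
      (∑ k, ({α k, β k} : Multiset ℝ)).countP ((α 0)⁻¹ < ·) < 2 * (n + 2) := by
  have h0 : 1 ≤ α 0 := h.one_le 0
  have hb0 : β 0 = (α 0)⁻¹ := h.pure 0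
  have hi0 : (α 0)⁻¹ ≤ 1 := inv_le_one_of_one_le₀ h0
  rw [← Multiset.coe_countPAddMonoidHom, ← Multiset.coe_countPAddMonoidHom, map_sum, map_sum,
    ← Finset.sum_add_distrib]
  have hlt : ∑ k : Fin (n + 2), (Multiset.countPAddMonoidHom (α 0 < ·) {α k, β k} +
      Multiset.countPAddMonoidHom ((α 0)⁻¹ < ·) {α k, β k}) < ∑ _k : Fin (n + 2), 2 := by
    have hg : ∀ k, Multiset.countPAddMonoidHom (α 0 < ·) {α k, β k} +
        Multiset.countPAddMonoidHom ((α 0)⁻¹ < ·) {α k, β k} =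
        ((if α 0 < β k then 1 else 0) + if α 0 < α k then 1 else 0) +
        ((if (α 0)⁻¹ < β k then 1 else 0) + if (α 0)⁻¹ < α k then 1 else 0) := fun k => by
      simp [Multiset.insert_eq_cons, Multiset.countP_cons, ← Multiset.cons_zero]
    refine Finset.sum_lt_sum (fun k _ => ?_) ⟨0, Finset.mem_univ _, ?_⟩
    · rw [hg]
      refine Fin.lastCases ?_ (fun k => ?_) k
      · have h1 : α (Fin.last _) ≤ α 0 ∨ β (Fin.last _) ≤ (α 0)⁻¹ := h.nested 0
        have h2 := h.last_le
        rcases h1 with h1 | h1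
        · rw [if_neg (by linarith), if_neg (by linarith)]
          split_ifs <;> simp
        · rw [if_neg (by linarith), if_neg (c := (α 0)⁻¹ < β _) (by linarith)]
          split_ifs <;> simp
      · have h1 := h.one_le k
        have h2 : (α k.castSucc)⁻¹ ≤ 1 := inv_le_one_of_one_le₀ h1
        rw [h.pure k, if_neg (by linarith)]
        rcases lt_or_ge (α 0) (α k.castSucc) with h3 | h3
        · have h4 : (α k.castSucc)⁻¹ ≤ (α 0)⁻¹ := inv_anti₀ (by linarith) h3.le
          rw [if_neg (c := (α 0)⁻¹ < (α k.castSucc)⁻¹) (by linarith)]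
          split_ifs <;> simp
        · rw [if_neg (by linarith)]
          split_ifs <;> simp
    · rw [hg, hb0, if_neg (by linarith), if_neg (lt_irrefl _), if_neg (lt_irrefl _)]
      split_ifs <;> simp
  simpa [mul_comm] using hlt

theorem IsComplexStructure.restrict {J : E →ₗ[ℝ] E} (hJ : IsComplexStructure J)
    {W : Submodule ℝ E} (hW : ∀ w ∈ W, J w ∈ W) : IsComplexStructure (J.restrict hW) where
  inner_map_map x y := hJ.inner_map_map x y
  map_map x := Subtype.ext (hJ.map_map x)

/-- With nested pairs as spectrum, `T` is diagonal in a basis adapted to the complex structure: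
`u k` and `J (u k)` are eigenvectors, and `u` is orthonormal for the Hermitian inner product
defined by `J`. -/
theorem exists_unitary_eigenframe (n : ℕ) : ∀ {E : Type*} [NormedAddCommGroup E]
    [InnerProductSpace ℝ E] [FiniteDimensional ℝ E] {T J : E →ₗ[ℝ] E} {α β : Fin (n + 1) → ℝ},
    finrank ℝ E = 2 * (n + 1) → T.IsSymmetric → IsComplexStructure J → SatisfiesUncertainty T J →
    IsNestedPairing α β → T.charpoly.roots = ∑ k, {α k, β k} →
    ∃ u : Fin (n + 1) → E, (∀ k l, ⟪u k, u l⟫_ℝ = if k = l then 1 else 0) ∧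
      (∀ k l, ⟪u k, J (u l)⟫_ℝ = 0) ∧
      ∀ k, T (u k) = α k • u k ∧ T (J (u k)) = β k • J (u k) := by
  induction n with
  | zero =>
    intro E _ _ _ T J α β hdim hT hJ _ _ hroots
    rw [Fin.sum_univ_one] at hroots
    have hev : Module.End.HasEigenvalue T (α 0) := by
      rw [Module.End.hasEigenvalue_iff_isRoot_charpoly]
      exact Polynomial.isRoot_of_mem_roots (by rw [hroots]; simp)
    obtain ⟨y, hy⟩ := hev.exists_hasEigenvector
    have hyn : ‖y‖ ≠ 0 := norm_ne_zero_iff.2 hy.2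
    let x : E := ‖y‖⁻¹ • y
    have hx1 : ‖x‖ = 1 := by simp [x, norm_smul, hyn]
    have hTx : T x = α 0 • x := by rw [map_smul, hy.apply_eq_smul, smul_comm]
    have hxJ := hJ.inner_self_map x
    have hJx1 : ‖J x‖ = 1 := by rw [hJ.norm_map, hx1]
    have hW0 : finrank ℝ (Submodule.span ℝ {x, J x})ᗮ = 0 := by
      have := finrank_orthogonal_pair hx1 hJx1 hxJ
      omega
    have hbot : (Submodule.span ℝ {x, J x})ᗮ = ⊥ := Submodule.finrank_eq_zero.1 hW0
    -- In the plane `E`, the vector `T (J x)` is orthogonal to `x`, hence a multiple of `J x`.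
    have hTJ : T (J x) = ⟪J x, T (J x)⟫_ℝ • J x := by
      rw [← sub_eq_zero, ← Submodule.mem_bot ℝ, ← hbot, Submodule.mem_orthogonal]
      intro z hz
      induction hz using Submodule.span_induction with
      | mem z hz =>
        rcases hz with rfl | rfl
        · rw [inner_sub_right, ← hT, hTx, real_inner_smul_left, real_inner_smul_right, hxJ]
          simp
        · rw [inner_sub_right, real_inner_smul_right, real_inner_self_eq_norm_sq, hJx1]
          simp
      | zero => simp
      | add z w _ _ hz hw => rw [inner_add_left, hz, hw, add_zero]
      | smul c z _ hz => rw [real_inner_smul_left, hz, mul_zero]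
    have hW : ∀ w ∈ (Submodule.span ℝ {x, J x})ᗮ, T w ∈ (Submodule.span ℝ {x, J x})ᗮ := by
      intro w hw
      rw [hbot, Submodule.mem_bot] at hw
      simp [hw]
    have hr := roots_charpoly_eq_cons_cons hT hx1 hJx1 hxJ hTx hTJ hW
    have hr0 : (T.restrict hW).charpoly.roots = 0 := by
      rw [← Multiset.card_eq_zero]
      have := (T.restrict hW).charpoly.card_roots'
      rw [LinearMap.charpoly_natDegree, hW0] at this
      omega
    rw [hr0, add_zero, hroots, Multiset.insert_eq_cons, Multiset.insert_eq_cons,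
      Multiset.cons_inj_right, Multiset.singleton_inj] at hr
    refine ⟨fun _ => x, fun k l => ?_, fun k l => hxJ, fun k => ?_⟩
    · rw [Fin.fin_one_eq_zero k, Fin.fin_one_eq_zero l, if_pos rfl, real_inner_self_eq_norm_sq,
        hx1, one_pow]
    · rw [Fin.fin_one_eq_zero k, hr]
      exact ⟨hTx, hTJ⟩
  | succ n ih =>
    intro E _ _ _ T J α β hdim hT hJ hU hα hroots
    have h0 : 1 ≤ α 0 := hα.one_le 0
    have hb0 : β 0 = (α 0)⁻¹ := hα.pure 0
    obtain ⟨x, hx1, hTx, hTJ⟩ := exists_pure_eigenvector hT hJ hU (a := α 0) (by linarith) (by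
      rw [hroots, hdim]; exact hα.countP_lt)
    have hxJ := hJ.inner_self_map x
    have hJx1 : ‖J x‖ = 1 := by rw [hJ.norm_map, hx1]
    have hdimW := finrank_orthogonal_pair hx1 hJx1 hxJ
    have hmem : ∀ w, w ∈ (Submodule.span ℝ {x, J x})ᗮ ↔ ⟪x, w⟫_ℝ = 0 ∧ ⟪J x, w⟫_ℝ = 0 := by
      intro w
      rw [Submodule.span_insert, ← Submodule.inf_orthogonal, Submodule.mem_inf,
        Submodule.mem_orthogonal_singleton_iff_inner_right,
        Submodule.mem_orthogonal_singleton_iff_inner_right]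
    have hTW : ∀ w ∈ (Submodule.span ℝ {x, J x})ᗮ, T w ∈ (Submodule.span ℝ {x, J x})ᗮ := by
      intro w hw
      rw [hmem] at hw ⊢
      rw [← hT, ← hT, hTx, hTJ, real_inner_smul_left, real_inner_smul_left, hw.1, hw.2]
      simp
    have hJW : ∀ w ∈ (Submodule.span ℝ {x, J x})ᗮ, J w ∈ (Submodule.span ℝ {x, J x})ᗮ := by
      intro w hw
      rw [hmem] at hw ⊢
      rw [hJ.inner_map_map, hw.1, ← neg_eq_zero, ← hJ.inner_map_left, hw.2]
      simp
    have hr := roots_charpoly_eq_cons_cons hT hx1 hJx1 hxJ hTx hTJ hTW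
    rw [hroots, Fin.sum_univ_succ, hb0, add_right_inj] at hr
    obtain ⟨u, hu, huJ, huT⟩ := ih (by omega) (hT.restrict_invariant hTW) (hJ.restrict hJW)
      (fun x y => hU x y) hα.tail hr.symm
    have hxu : ∀ k, ⟪x, (u k : E)⟫_ℝ = 0 ∧ ⟪J x, (u k : E)⟫_ℝ = 0 := fun k =>
      (hmem _).1 (u k).2
    refine ⟨Fin.cons x fun k => (u k : E), fun k l => ?_, fun k l => ?_, fun k => ?_⟩
    · refine Fin.cases ?_ (fun k => ?_) k <;> refine Fin.cases ?_ (fun l => ?_) l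
      · simp [hx1]
      · simp [(hxu l).1, (Fin.succ_ne_zero l).symm]
      · simp [real_inner_comm, (hxu k).1]
      · simpa using hu k l
    · refine Fin.cases ?_ (fun k => ?_) k <;> refine Fin.cases ?_ (fun l => ?_) l
      · simpa using hxJ
      · rw [← neg_eq_zero, Fin.cons_zero, Fin.cons_succ, ← hJ.inner_map_left, (hxu l).2]
      · rw [Fin.cons_zero, Fin.cons_succ, real_inner_comm, (hxu k).2]
      · exact huJ k l
    · refine Fin.cases ?_ (fun k => ?_) k
      · rw [hb0]; exact ⟨hTx, hTJ⟩
      · exact ⟨congrArg Subtype.val (huT k).1, congrArg Subtype.val (huT k).2⟩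

end NormalForm

/-! ### Eigenvalue pairs from perfect matchings -/

section Pairing

variable {n : ℕ} {Λ : Fin n → ℝ}

theorem ncard_pureEdges_of_sameUpToDegeneracy {M M' : (pairingGraph Λ).Subgraph}
    (h : SameUpToDegeneracy Λ M M') : (pureEdges Λ M').ncard = (pureEdges Λ M).ncard := by
  obtain ⟨σ, hσ, hE⟩ := h
  have : pureEdges Λ M' = Sym2.map σ '' pureEdges Λ M := by
    ext e
    simp only [pureEdges, Set.mem_ofPred_eq, Set.mem_image, hE]
    constructor
    · rintro ⟨⟨e, he, rfl⟩, i, j, hij, h1⟩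
      refine ⟨e, ⟨he, σ.symm i, σ.symm j, ?_, ?_⟩, rfl⟩
      · apply Sym2.map.injective σ.injective
        simpa using hij
      · rw [← hσ, ← hσ (σ.symm j)]
        simpa using h1
    · rintro ⟨e, ⟨he, i, j, rfl, h1⟩, rfl⟩
      exact ⟨⟨_, he, rfl⟩, σ i, σ j, rfl, by rw [hσ, hσ, h1]⟩
  rw [this, Set.ncard_image_of_injective _ (Sym2.map.injective σ.injective)]

/-- If a pure edge `{u, v}` and another edge `{x, y}` satisfy `λ_u < λ_x` and `λ_v < λ_y`, then
exchanging `u` and `x` gives a perfect matching with fewer pure edges. -/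
theorem nested_of_unique {M : (pairingGraph Λ).Subgraph} (hM : M.IsPerfectMatching)
    (huniq : ∀ M' : (pairingGraph Λ).Subgraph, M'.IsPerfectMatching → SameUpToDegeneracy Λ M M')
    (hpos : ∀ i, 0 < Λ i) {u v x y : Fin n} (huv : M.Adj u v) (hxy : M.Adj x y)
    (hpure : Λ u * Λ v = 1) : Λ x ≤ Λ u ∨ Λ y ≤ Λ v := by
  by_contra! hlt
  obtain ⟨h1, h2⟩ := hlt
  have hux : u ≠ x := by rintro rfl; exact lt_irrefl _ h1
  have hvy : v ≠ y := by rintro rfl; exact lt_irrefl _ h2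
  have hm := hM.1
  have hxv : 1 < Λ x * Λ v := by
    have := mul_lt_mul_of_pos_right h1 (hpos v)
    linarith
  have huy : 1 < Λ u * Λ y := by
    have := mul_lt_mul_of_pos_left h2 (hpos u)
    linarith
  have hxv' : x ≠ v := by
    rintro rfl
    rw [hm.eq_of_adj_left hxy huv.symm] at h2
    exact h1.not_gt h2
  have hyu' : y ≠ u := by
    rintro rfl
    exact hxv' (hm.eq_of_adj_left hxy.symm huv)
  let σ := Equiv.swap u x
  have hσy : σ y = y := Equiv.swap_apply_of_ne_of_ne hyu' hxy.adj_sub.ne'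
  have hσv : σ v = v := Equiv.swap_apply_of_ne_of_ne huv.adj_sub.ne' hxv'.symm
  have hσ : ∀ p q, σ p = q ↔ p = σ q := fun p q => Equiv.swap_apply_eq_iff
  -- The edges of the exchanged matching that are not edges of `M` are `{x, v}` and `{u, y}`.
  have key : ∀ p q, M.Adj (σ p) (σ q) → M.Adj p q ∨ 1 < Λ p * Λ q := by
    intro p q h
    by_cases hpu : p = u
    · subst hpu
      rw [show σ p = x from Equiv.swap_apply_left _ _] at h
      rw [(hσ q y).1 (hm.eq_of_adj_left h hxy), hσy]
      exact Or.inr huy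
    by_cases hpx : p = x
    · subst hpx
      rw [show σ p = u from Equiv.swap_apply_right _ _] at h
      rw [(hσ q v).1 (hm.eq_of_adj_left h huv), hσv]
      exact Or.inr hxv
    rw [show σ p = p from Equiv.swap_apply_of_ne_of_ne hpu hpx] at h
    by_cases hqu : q = u
    · subst hqu
      rw [show σ q = x from Equiv.swap_apply_left _ _] at h
      rw [hm.eq_of_adj_right h hxy.symm, mul_comm]
      exact Or.inr huy
    by_cases hqx : q = x
    · subst hqx
      rw [show σ q = u from Equiv.swap_apply_right _ _] at h
      rw [hm.eq_of_adj_right h huv.symm, mul_comm]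
      exact Or.inr hxv
    rw [show σ q = q from Equiv.swap_apply_of_ne_of_ne hqu hqx] at h
    exact Or.inl h
  let M' : (pairingGraph Λ).Subgraph :=
    { verts := Set.univ
      Adj p q := M.Adj (σ p) (σ q)
      adj_sub {p q} h := ⟨fun hpq => h.ne (congrArg σ hpq),
        (key p q h).elim (fun h' => h'.adj_sub.2) le_of_lt⟩
      edge_vert _ := Set.mem_univ _
      symm := ⟨fun _ _ h => h.symm⟩ }
  have hM' : M'.IsPerfectMatching := by
    rw [SimpleGraph.Subgraph.isPerfectMatching_iff] at hM ⊢
    intro p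
    obtain ⟨w, hw, hw'⟩ := hM (σ p)
    exact ⟨σ.symm w, by simpa [M'] using hw, fun q hq => by rw [← hw' _ hq, σ.symm_apply_apply]⟩
  have hss : pureEdges Λ M' ⊂ pureEdges Λ M := by
    refine (Set.ssubset_iff_of_subset ?_).2 ⟨s(u, v), ⟨huv, u, v, rfl, hpure⟩, ?_⟩
    · rintro e ⟨he, p, q, rfl, h⟩
      refine ⟨(key p q he).elim id fun h' => absurd h h'.ne', p, q, rfl, h⟩
    · rintro ⟨he, -⟩
      have he' : M.Adj (σ u) (σ v) := he
      rw [hσv, show σ u = x from Equiv.swap_apply_left _ _] at he'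
      exact hux (hm.eq_of_adj_right huv he')
  exact (Set.ncard_lt_ncard hss (Set.toFinite _)).ne
    (ncard_pureEdges_of_sameUpToDegeneracy (huniq M' hM'))

/-- The edges of a perfect matching, enumerated with their ends in decreasing order, list the
eigenvalues in pairs. If all but at most one of the `m + 1` edges are pure, the exception can be
put last. -/
theorem exists_isNestedPairing {m : ℕ} {Λ : Fin (2 * (m + 1)) → ℝ} (hΛ : PureUniquePairing m Λ)
    (hpos : ∀ i, 0 < Λ i) :
    ∃ α β : Fin (m + 1) → ℝ, IsNestedPairing α β ∧
      (∀ k, 0 < β k ∧ β k ≤ α k ∧ 1 ≤ α k * β k) ∧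
      Finset.univ.val.map Λ = ∑ k, {α k, β k} := by
  classical
  obtain ⟨M, hM, huniq, hcard⟩ := hΛ
  have hm := hM.1
  have hends : ∀ e : M.edgeSet, ∃ p : Fin (2 * (m + 1)) × Fin (2 * (m + 1)),
      (e : Sym2 _) = s(p.1, p.2) ∧ M.Adj p.1 p.2 ∧ Λ p.2 ≤ Λ p.1 := by
    rintro ⟨e, he⟩
    induction e using Sym2.ind with
    | _ u v =>
      rcases le_total (Λ v) (Λ u) with h | h
      · exact ⟨(u, v), rfl, he, h⟩
      · exact ⟨(v, u), Sym2.eq_swap, SimpleGraph.Subgraph.Adj.symm he, h⟩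
  choose p hp hadj hle using hends
  let g : M.edgeSet ⊕ M.edgeSet → Fin (2 * (m + 1)) :=
    Sum.elim (fun e => (p e).1) (fun e => (p e).2)
  have hg : Function.Bijective g := by
    have heq : ∀ e e' : M.edgeSet, ∀ w, w ∈ e.1 → w ∈ e'.1 → e = e' := by
      rintro ⟨e, he⟩ ⟨e', he'⟩ w ⟨a, rfl⟩ ⟨b, rfl⟩
      obtain rfl : a = b := hm.eq_of_adj_left he he'
      rfl
    have hl : ∀ e, (p e).1 ∈ e.1 := fun e => by
      rw [hp]; exact Sym2.mem_mk_left _ _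
    have hr : ∀ e, (p e).2 ∈ e.1 := fun e => by
      rw [hp]; exact Sym2.mem_mk_right _ _
    constructor
    · rintro (e | e) (e' | e') h
      · rw [heq e e' _ (hl e) ((show (p e).1 = (p e').1 from h) ▸ hl e')]
      · have h' : (p e).1 = (p e').2 := h
        have := heq e e' _ (hl e) (h' ▸ hr e')
        subst this
        exact absurd h' (hadj e).ne
      · have h' : (p e).2 = (p e').1 := h
        have := heq e e' _ (hr e) (h' ▸ hl e')
        subst this
        exact absurd h'.symm (hadj e).ne
      · rw [heq e e' _ (hr e) ((show (p e).2 = (p e').2 from h) ▸ hr e')]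
    · intro w
      obtain ⟨w', hw, -⟩ := hm (hM.2 w)
      let e : M.edgeSet := ⟨s(w, w'), hw⟩
      have : w ∈ s((p e).1, (p e).2) := by rw [← hp]; exact Sym2.mem_mk_left _ _
      rcases Sym2.mem_iff.1 this with h | h
      · exact ⟨Sum.inl e, h.symm⟩
      · exact ⟨Sum.inr e, h.symm⟩
  have hcardE : Fintype.card M.edgeSet = m + 1 := by
    have := Fintype.card_of_bijective hg
    rw [Fintype.card_sum, Fintype.card_fin] at this
    omega
  obtain ⟨e₀, he₀⟩ : ∃ e₀ : M.edgeSet, ∀ e ≠ e₀, Λ (p e).1 * Λ (p e).2 = 1 := by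
    let s : Finset M.edgeSet := Finset.univ.filter fun e => Λ (p e).1 * Λ (p e).2 ≠ 1
    have hs : s.card ≤ 1 := by
      have h1 : (pureEdges Λ M).ncard ≤ sᶜ.card := by
        rw [← Finset.card_map (Function.Embedding.subtype _), ← Set.ncard_coe_finset]
        refine Set.ncard_le_ncard ?_ (Set.toFinite _)
        rintro e ⟨he, i, j, hij, h⟩
        have h2 := (hp ⟨e, he⟩).symm.trans hij
        simp only [Finset.coe_map, Set.mem_image, Finset.mem_coe]
        refine ⟨⟨e, he⟩, ?_, rfl⟩
        simp only [s, Finset.mem_compl, Finset.mem_filter, Finset.mem_univ, true_and, not_not]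
        rcases Sym2.eq_iff.1 h2 with ⟨h3, h4⟩ | ⟨h3, h4⟩
        · rw [h3, h4, h]
        · rw [h3, h4, mul_comm, h]
      have h2 := s.card_add_card_compl
      omega
    have : Nonempty M.edgeSet := Fintype.card_pos_iff.1 (by omega)
    rcases s.eq_empty_or_nonempty with h | ⟨e₀, h⟩
    · refine ⟨Classical.arbitrary _, fun e _ => ?_⟩
      by_contra hne
      exact Finset.notMem_empty e (h ▸ Finset.mem_filter.2 ⟨Finset.mem_univ _, hne⟩)
    · refine ⟨e₀, fun e hne => ?_⟩
      by_contra hne'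
      exact hne (Finset.card_le_one.1 hs e (Finset.mem_filter.2 ⟨Finset.mem_univ _, hne'⟩) e₀ h)
  let φ₀ : Fin (m + 1) ≃ M.edgeSet := (Fintype.equivFinOfCardEq hcardE).symm
  let φ : Fin (m + 1) ≃ M.edgeSet := φ₀.trans (Equiv.swap (φ₀ (Fin.last m)) e₀)
  have hφ : φ (Fin.last m) = e₀ := Equiv.swap_apply_left _ _
  have hpure : ∀ k : Fin m, Λ (p (φ k.castSucc)).1 * Λ (p (φ k.castSucc)).2 = 1 := fun k =>
    he₀ _ fun h => (Fin.castSucc_lt_last k).ne (φ.injective (h.trans hφ.symm))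
  have hinv : ∀ k : Fin m, Λ (p (φ k.castSucc)).2 = (Λ (p (φ k.castSucc)).1)⁻¹ := fun k =>
    eq_inv_of_mul_eq_one_right (hpure k)
  refine ⟨fun k => Λ (p (φ k)).1, fun k => Λ (p (φ k)).2, ⟨fun k => ?_, hinv, fun k => ?_, hle _⟩,
    fun k => ⟨hpos _, hle _, (hadj _).adj_sub.2⟩, ?_⟩
  · have h1 := hpure k
    have h2 := hle (φ k.castSucc)
    have h3 := hpos (p (φ k.castSucc)).1
    nlinarith
  · rw [← hinv]
    exact nested_of_unique hM huniq hpos (hadj _) (hadj _) (hpure k)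
  · let G : Fin (m + 1) ⊕ Fin (m + 1) ≃ Fin (2 * (m + 1)) :=
      (Equiv.sumCongr φ φ).trans (Equiv.ofBijective g hg)
    rw [← Finset.sum_multiset_singleton, ← Multiset.coe_mapAddMonoidHom, map_sum,
      ← Equiv.sum_comp G, Fintype.sum_sum_type, ← Finset.sum_add_distrib]
    rfl

end Pairing

/-! ### Uniqueness of thermal and squeezing parameters -/

section Williamson

open Matrix

variable {S : ℕ}

theorem IsOS.mul {A B : PhaseMatrix S} (hA : IsOS A) (hB : IsOS B) : IsOS (A * B) :=
  ⟨mul_mem hA.1 hB.1, mul_mem hA.2 hB.2⟩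

theorem IsOS.transpose {A : PhaseMatrix S} (hA : IsOS A) : IsOS Aᵀ :=
  ⟨SymplecticGroup.transpose_mem hA.1, Matrix.transpose_mem_unitaryGroup_iff.2 hA.2⟩

theorem IsOS.one : IsOS (1 : PhaseMatrix S) := ⟨one_mem _, one_mem _⟩

theorem IsOS.mul_transpose {A : PhaseMatrix S} (hA : IsOS A) : A * Aᵀ = 1 :=
  (mem_orthogonalGroup_iff _ _).1 hA.2

theorem IsOS.transpose_mul {A : PhaseMatrix S} (hA : IsOS A) : Aᵀ * A = 1 :=
  (mem_orthogonalGroup_iff' _ _).1 hA.2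

theorem squeezingMatrix_mem_symplecticGroup (r : Fin S → ℝ) :
    squeezingMatrix r ∈ symplecticGroup (Fin S) ℝ := by
  rw [SymplecticGroup.mem_iff, squeezingMatrix, diagonal_transpose, J, ← fromBlocks_diagonal]
  simp only [fromBlocks_multiply, Matrix.mul_zero, Matrix.zero_mul, Matrix.mul_one, Matrix.mul_neg,
    Matrix.neg_mul, diagonal_mul_diagonal, ← Real.exp_add, add_neg_cancel, neg_add_cancel,
    Real.exp_zero, diagonal_one, add_zero, zero_add]

theorem thermalMatrix_mul_J (ν : Fin S → ℝ) :
    thermalMatrix ν * J (Fin S) ℝ = J (Fin S) ℝ * thermalMatrix ν := by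
  rw [thermalMatrix, J, ← fromBlocks_diagonal]
  simp [-fromBlocks_diagonal, fromBlocks_multiply]

theorem roots_charpoly_diagonal {ι : Type*} [Fintype ι] [DecidableEq ι] (d : ι → ℝ) :
    (diagonal d).charpoly.roots = Finset.univ.val.map d := by
  rw [charpoly_diagonal, ← Polynomial.roots_multiset_prod_X_sub_C (Finset.univ.val.map d),
    Multiset.map_map]
  rfl

theorem map_sumElim {ι κ γ : Type*} [Fintype ι] [Fintype κ] (f : ι → γ) (g : κ → γ) :
    Finset.univ.val.map (Sum.elim f g) = Finset.univ.val.map f + Finset.univ.val.map g := by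
  rw [← Finset.univ_disjSum_univ]
  simp [Finset.disjSum, Multiset.disjSum]

theorem map_eq_of_map_sumElim_eq {ι κ γ : Type*} [Fintype ι] [Fintype κ] {f : ι → γ} {g : κ → γ}
    (h : Finset.univ.val.map (Sum.elim f f) = Finset.univ.val.map (Sum.elim g g)) :
    Finset.univ.val.map f = Finset.univ.val.map g := by
  rw [map_sumElim, map_sumElim, ← two_nsmul, ← two_nsmul] at h
  exact nsmul_right_injective two_ne_zero h

/-- A symplectic matrix that carries one thermal matrix to another by congruence is
orthogonal: it intertwines `T Ω` and `T' Ω`, hence `T²` and `T'²`, hence `T` and `T'`. -/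
theorem mul_transpose_eq_one_of_congruent {C : PhaseMatrix S} (hC : C ∈ symplecticGroup (Fin S) ℝ)
    {ν ν' : Fin S → ℝ} (hν : ∀ k, 0 < ν k) (hν' : ∀ k, 0 < ν' k)
    (h : C * thermalMatrix ν * Cᵀ = thermalMatrix ν') :
    C * Cᵀ = 1 := by
  have hpos : ∀ i, 0 < Sum.elim ν ν i := by rintro (i | i) <;> simp [hν]
  have hpos' : ∀ i, 0 < Sum.elim ν' ν' i := by rintro (i | i) <;> simp [hν']
  have hCJ := SymplecticGroup.mem_iff'.1 hC
  set T := thermalMatrix ν with hT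
  set T' := thermalMatrix ν' with hT'
  set j := J (Fin S) ℝ with hj
  have hTj : T * j = j * T := thermalMatrix_mul_J ν
  have hTj' : T' * j = j * T' := thermalMatrix_mul_J ν'
  have hjj : j * j = -1 := J_squared _ _
  have h1 : C * T * j = T' * j * C := by
    calc C * T * j = C * T * (Cᵀ * j * C) := by rw [hCJ]
      _ = C * T * Cᵀ * j * C := by simp only [Matrix.mul_assoc]
      _ = T' * j * C := by rw [h]
  have h2 : C * (T * T) = T' * T' * C := by
    have h3 : C * (T * j) * (T * j) = T' * j * (T' * j) * C := by
      rw [← Matrix.mul_assoc C T j, h1, Matrix.mul_assoc (T' * j) C, ← Matrix.mul_assoc C T j, h1]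
      simp only [Matrix.mul_assoc]
    have h4 : ∀ X : PhaseMatrix S, X * j = j * X → X * j * (X * j) = -(X * X) := fun X hX => by
      rw [Matrix.mul_assoc, ← Matrix.mul_assoc j, ← hX, Matrix.mul_assoc X j, hjj]
      simp
    rw [Matrix.mul_assoc, h4 T hTj, h4 T' hTj'] at h3
    simpa using h3
  have h5 : C * T = T' * C := by
    ext i k
    have h6 := congrFun (congrFun h2 i) k
    rw [hT, hT', thermalMatrix, thermalMatrix] at h6 ⊢
    rw [diagonal_mul_diagonal, diagonal_mul_diagonal, mul_diagonal, diagonal_mul] at h6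
    rw [mul_diagonal, diagonal_mul]
    have h7 : (C i k * Sum.elim ν ν k - Sum.elim ν' ν' i * C i k) *
        (Sum.elim ν ν k + Sum.elim ν' ν' i) = 0 := by linear_combination h6
    rcases mul_eq_zero.1 h7 with h8 | h8
    · linarith
    · linarith [hpos k, hpos' i]
  rw [h5, Matrix.mul_assoc] at h
  ext i k
  have h6 := congrFun (congrFun h i) k
  rw [hT', thermalMatrix, diagonal_mul, diagonal_apply] at h6
  rw [one_apply]
  split_ifs at h6 ⊢
  · exact (mul_eq_left₀ (hpos' i).ne').1 h6
  · exact (mul_eq_zero.1 h6).resolve_left (hpos' i).ne'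

/-- The thermal and squeezing parameters are determined by the matrix: two decompositions
`A T Aᵀ = A' T' A'ᵀ` differ by the orthogonal matrix `A'⁻¹ A`, which conjugates `T` to `T'`, so `T`
and `T'` have the same spectrum, and so do `A Aᵀ = K Q² Kᵀ` and `A' A'ᵀ`. -/
theorem HasParameters.unique {Γ : PhaseMatrix S} {ν r ν' r' : Fin S → ℝ}
    (h : HasParameters Γ ν r) (h' : HasParameters Γ ν' r') :
    Finset.univ.val.map ν = Finset.univ.val.map ν' ∧
      Finset.univ.val.map (fun k => |r k|) = Finset.univ.val.map fun k => |r' k| := by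
  obtain ⟨hν, K, L, hK, hL, hΓ⟩ := h
  obtain ⟨hν', K', L', hK', hL', hΓ'⟩ := h'
  have hAA : ∀ {K L : PhaseMatrix S} (r : Fin S → ℝ), IsOS K → IsOS L →
      ((K * squeezingMatrix r * L) * (K * squeezingMatrix r * L)ᵀ).charpoly.roots =
        Finset.univ.val.map (Sum.elim (fun k => Real.exp (2 * r k))
          fun k => Real.exp (-(2 * r k))) := by
    intro K L r hK hL
    have hQ : squeezingMatrix r * squeezingMatrix r =
        diagonal (Sum.elim (fun k => Real.exp (2 * r k)) fun k => Real.exp (-(2 * r k))) := by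
      rw [squeezingMatrix, diagonal_mul_diagonal]
      congr 1
      ext (k | k) <;> simp [← Real.exp_add] <;> ring
    have hQt : (squeezingMatrix r)ᵀ = squeezingMatrix r := diagonal_transpose _
    rw [show (K * squeezingMatrix r * L) * (K * squeezingMatrix r * L)ᵀ =
      K * (squeezingMatrix r * (L * Lᵀ) * squeezingMatrix r * Kᵀ) by
        simp only [Matrix.transpose_mul, hQt, Matrix.mul_assoc], hL.mul_transpose, Matrix.mul_one,
      charpoly_mul_comm, Matrix.mul_assoc, hK.transpose_mul, Matrix.mul_one, hQ,
      roots_charpoly_diagonal]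
  let a : symplecticGroup (Fin S) ℝ := ⟨K * squeezingMatrix r * L,
    mul_mem (mul_mem hK.1 (squeezingMatrix_mem_symplecticGroup r)) hL.1⟩
  let a' : symplecticGroup (Fin S) ℝ := ⟨K' * squeezingMatrix r' * L',
    mul_mem (mul_mem hK'.1 (squeezingMatrix_mem_symplecticGroup r')) hL'.1⟩
  have h1 := hAA r hK hL
  have h1' := hAA r' hK' hL'
  rw [show K * squeezingMatrix r * L = (a : PhaseMatrix S) from rfl] at hΓ h1
  rw [show K' * squeezingMatrix r' * L' = (a' : PhaseMatrix S) from rfl] at hΓ' h1'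
  obtain ⟨c, hc⟩ : ∃ c, a = a' * c := ⟨a'⁻¹ * a, by simp⟩
  have hac : (a : PhaseMatrix S) = a' * c := by rw [hc]; rfl
  set b : PhaseMatrix S := (a' : PhaseMatrix S)
  let b' : PhaseMatrix S := (a'⁻¹ : symplecticGroup (Fin S) ℝ)
  have hinv : b' * b = 1 := congrArg Subtype.val (inv_mul_cancel a')
  have hinv' : bᵀ * b'ᵀ = 1 := by rw [← Matrix.transpose_mul, hinv, transpose_one]
  have hcong : (c : PhaseMatrix S) * thermalMatrix ν * (c : PhaseMatrix S)ᵀ = thermalMatrix ν' := by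
    have h2 : b * (c * thermalMatrix ν * (c : PhaseMatrix S)ᵀ) * bᵀ =
        b * thermalMatrix ν' * bᵀ := by
      rw [← hΓ', hΓ, hac]
      simp only [Matrix.transpose_mul, Matrix.mul_assoc]
    have h3 := congrArg (fun X => b' * X * b'ᵀ) h2
    simp only [Matrix.mul_assoc, hinv', Matrix.mul_one] at h3
    simpa only [← Matrix.mul_assoc, hinv, Matrix.one_mul] using h3
  have h5 := mul_transpose_eq_one_of_congruent c.2 hν hν' hcong
  constructor
  · have h6 : (thermalMatrix ν').charpoly = (thermalMatrix ν).charpoly := by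
      rw [← hcong, Matrix.mul_assoc, charpoly_mul_comm, Matrix.mul_assoc, mul_eq_one_comm.1 h5,
        Matrix.mul_one]
    have h7 := roots_charpoly_diagonal (Sum.elim ν' ν')
    rw [← thermalMatrix, h6, thermalMatrix, roots_charpoly_diagonal] at h7
    exact map_eq_of_map_sumElim_eq h7
  · have h6 : (a : PhaseMatrix S) * (a : PhaseMatrix S)ᵀ = b * bᵀ := by
      rw [hac, Matrix.transpose_mul, Matrix.mul_assoc, ← Matrix.mul_assoc _ _ bᵀ, h5,
        Matrix.one_mul]
    rw [h6, h1'] at h1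
    have h7 := congrArg (Multiset.map fun x => |Real.log x| / 2) h1
    rw [Multiset.map_map, Multiset.map_map] at h7
    have h8 : ∀ r : Fin S → ℝ, (fun x => |Real.log x| / 2) ∘ Sum.elim
        (fun k => Real.exp (2 * r k)) (fun k => Real.exp (-(2 * r k))) =
        Sum.elim (fun k => |r k|) fun k => |r k| := fun r => by
      ext (k | k) <;> simp [abs_mul]
    rw [h8, h8] at h7
    exact (map_eq_of_map_sumElim_eq h7).symm

end Williamson

/-! ### Covariance matrices as operators -/

section Diagonalization

open Matrix Module
open scoped InnerProductSpace

variable {S : ℕ}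

theorem inner_toLp_eq_dotProduct {ι : Type*} [Fintype ι] (x y : EuclideanSpace ℝ ι) :
    ⟪x, y⟫_ℝ = x.ofLp ⬝ᵥ y.ofLp := by
  rw [EuclideanSpace.inner_eq_star_dotProduct, star_trivial, dotProduct_comm]

theorem ofLp_toEuclideanLin_eq_mulVec {ι : Type*} [Fintype ι] [DecidableEq ι] (A : Matrix ι ι ℝ)
    (x : EuclideanSpace ℝ ι) : (A.toEuclideanLin x).ofLp = A *ᵥ x.ofLp := rfl

theorem J_mulVec (x : Fin S ⊕ Fin S → ℝ) :
    J (Fin S) ℝ *ᵥ x = Sum.elim (fun k => -x (Sum.inr k)) (fun k => x (Sum.inl k)) := by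
  rw [J, fromBlocks_mulVec]
  ext (k | k) <;> simp [neg_mulVec]

theorem vecMul_J (x : Fin S ⊕ Fin S → ℝ) :
    x ᵥ* J (Fin S) ℝ = Sum.elim (fun k => x (Sum.inr k)) (fun k => -x (Sum.inl k)) := by
  rw [J, vecMul_fromBlocks]
  ext (k | k) <;> simp [vecMul_neg]

theorem isComplexStructure_J (S : ℕ) : IsComplexStructure (J (Fin S) ℝ).toEuclideanLin where
  inner_map_map x y := by
    simp only [inner_toLp_eq_dotProduct, ofLp_toEuclideanLin_eq_mulVec, J_mulVec, dotProduct,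
      Fintype.sum_sum_type, Sum.elim_inl, Sum.elim_inr, neg_mul_neg]
    exact add_comm _ _
  map_map x := by
    ext i
    rw [ofLp_toEuclideanLin_eq_mulVec, ofLp_toEuclideanLin_eq_mulVec, mulVec_mulVec, J_squared]
    simp [neg_mulVec]

theorem symplForm_eq_neg_J (S : ℕ) : symplForm S = -J (Fin S) ℝ := by
  rw [symplForm, J, fromBlocks_neg]
  simp

theorem charpoly_toEuclideanLin {ι : Type*} [Fintype ι] [DecidableEq ι] (A : Matrix ι ι ℝ) :
    A.toEuclideanLin.charpoly = A.charpoly := by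
  rw [toEuclideanLin_eq_toLin_orthonormal, charpoly_toLin]

theorem IsQuantumCM.isSymmetric {Γ : PhaseMatrix S} (h : IsQuantumCM Γ) :
    Γ.toEuclideanLin.IsSymmetric := by
  rw [isSymmetric_toEuclideanLin_iff, Matrix.IsHermitian, conjTranspose_eq_transpose_of_trivial]
  exact h.1

/-- Read off from the real part of the Hermitian form `Γ + iΩ` at `x + iy`. -/
theorem IsQuantumCM.satisfiesUncertainty {Γ : PhaseMatrix S} (h : IsQuantumCM Γ) :
    SatisfiesUncertainty Γ.toEuclideanLin (J (Fin S) ℝ).toEuclideanLin := by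
  intro x y
  have hmap : ∀ (A : PhaseMatrix S) (v : Fin S ⊕ Fin S → ℝ),
      A.map (fun x : ℝ => (x : ℂ)) *ᵥ (fun i => (v i : ℂ)) = fun i => (((A *ᵥ v) i : ℝ) : ℂ) := by
    intro A v
    ext i
    exact (Complex.ofRealHom.map_mulVec A v i).symm
  have hdot : ∀ v w : Fin S ⊕ Fin S → ℝ,
      (fun i => (v i : ℂ)) ⬝ᵥ (fun i => (w i : ℂ)) = ((v ⬝ᵥ w : ℝ) : ℂ) := fun v w => by
    simp [dotProduct]
  let v : Fin S ⊕ Fin S → ℂ := (fun i => (x i : ℂ)) + Complex.I • fun i => (y i : ℂ)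
  have hv : star v = (fun i => (x i : ℂ)) - Complex.I • fun i => (y i : ℂ) := by
    ext i
    simp [v, sub_eq_add_neg]
  have h0 := (Complex.le_def.1 (h.2.dotProduct_mulVec_nonneg v)).1
  have hxy : x.ofLp ⬝ᵥ (J (Fin S) ℝ *ᵥ y.ofLp) = -((J (Fin S) ℝ *ᵥ x.ofLp) ⬝ᵥ y.ofLp) := by
    have := (isComplexStructure_J S).inner_map_left x y
    simp only [inner_toLp_eq_dotProduct, ofLp_toEuclideanLin_eq_mulVec] at this
    linarith
  rw [hv] at h0
  simp only [v, add_mulVec, mulVec_add, mulVec_smul, smul_mulVec, hmap, sub_dotProduct,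
    dotProduct_add, smul_dotProduct, dotProduct_smul, hdot, symplForm_eq_neg_J, neg_mulVec,
    dotProduct_neg] at h0
  simp only [Complex.add_re, Complex.sub_re, Complex.mul_re, smul_eq_mul, Complex.I_re,
    Complex.I_im, Complex.ofReal_re, Complex.ofReal_im, Complex.add_im, Complex.sub_im,
    Complex.mul_im, Complex.zero_re] at h0
  simp only [inner_toLp_eq_dotProduct, ofLp_toEuclideanLin_eq_mulVec]
  rw [dotProduct_comm (Γ *ᵥ x.ofLp), dotProduct_comm (Γ *ᵥ y.ofLp)]
  have h1 := dotProduct_comm y.ofLp (J (Fin S) ℝ *ᵥ x.ofLp)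
  linarith

theorem pos_of_hasEigenvalue {E : Type*} [NormedAddCommGroup E] [InnerProductSpace ℝ E]
    {T J : E →ₗ[ℝ] E} (hJ : IsComplexStructure J) (hU : SatisfiesUncertainty T J) {a : ℝ}
    (ha : Module.End.HasEigenvalue T a) : 0 < a := by
  obtain ⟨x, hx⟩ := ha.exists_hasEigenvector
  have hn : 0 < ‖x‖ ^ 2 := pow_pos (norm_pos_iff.2 hx.2) 2
  by_contra! hle
  -- A non-positive `a` would make `2 t ‖x‖² ≤ t² m` for every `t`.
  set m := ⟪T (J x), J x⟫_ℝ with hm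
  have key : ∀ t : ℝ, 2 * (t * ‖x‖ ^ 2) ≤ a * ‖x‖ ^ 2 + t * (t * m) := fun t => by
    have := hU x (t • J x)
    simpa only [map_smul, real_inner_smul_left, real_inner_smul_right, hJ.inner_map_map,
      real_inner_self_eq_norm_sq, hx.apply_eq_smul] using this
  have hk : 0 < |m| + ‖x‖ ^ 2 := by positivity
  have h1 := key (‖x‖ ^ 2 / (|m| + ‖x‖ ^ 2))
  have h2 : a * ‖x‖ ^ 2 ≤ 0 := mul_nonpos_of_nonpos_of_nonneg hle hn.le
  have h3 : 0 < ‖x‖ ^ 2 / (|m| + ‖x‖ ^ 2) := div_pos hn hk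
  have h4 : ‖x‖ ^ 2 / (|m| + ‖x‖ ^ 2) * m ≤ ‖x‖ ^ 2 := by
    rw [div_mul_eq_mul_div, div_le_iff₀ hk]
    nlinarith [le_abs_self m]
  nlinarith [mul_le_mul_of_nonneg_left h4 h3.le, mul_pos h3 hn]

theorem IsQuantumCM.eigenvalue_pos {Γ : PhaseMatrix S} (h : IsQuantumCM Γ) {Λ : Fin (2 * S) → ℝ}
    (hΛ : HasEigenspectrum Γ Λ) (i : Fin (2 * S)) : 0 < Λ i := by
  refine pos_of_hasEigenvalue (isComplexStructure_J S) h.satisfiesUncertainty ?_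
  rw [Module.End.hasEigenvalue_iff_isRoot_charpoly, charpoly_toEuclideanLin]
  refine Polynomial.isRoot_of_mem_roots ?_
  rw [hΛ]
  exact Multiset.mem_map_of_mem _ (Finset.mem_univ i)

/-- The columns of `W` are the vectors `u k` and `J (u k)` of a unitary eigenframe: it is orthogonal
as they are orthonormal, and symplectic as it commutes with `J`. -/
theorem IsQuantumCM.exists_diagonalization {n : ℕ} {Γ : PhaseMatrix (n + 1)} (h : IsQuantumCM Γ)
    {α β : Fin (n + 1) → ℝ} (hαβ : IsNestedPairing α β)
    (hΓ : Γ.charpoly.roots = ∑ k, {α k, β k}) :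
    ∃ W, IsOS W ∧ Γ = W * diagonal (Sum.elim α β) * Wᵀ := by
  have hJ := isComplexStructure_J (n + 1)
  obtain ⟨u, hu, huJ, huT⟩ := exists_unitary_eigenframe n (by simp; ring) h.isSymmetric hJ
    h.satisfiesUncertainty hαβ (by rw [charpoly_toEuclideanLin, hΓ])
  set j := (J (Fin (n + 1)) ℝ).toEuclideanLin with hj
  let w : Fin (n + 1) ⊕ Fin (n + 1) → EuclideanSpace ℝ (Fin (n + 1) ⊕ Fin (n + 1)) :=
    Sum.elim u (fun k => j (u k))
  let W : PhaseMatrix (n + 1) := Matrix.of fun i l => w l i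
  have hmul : ∀ (A : PhaseMatrix (n + 1)) i l, (A * W) i l = A.toEuclideanLin (w l) i :=
    fun A i l => by rw [ofLp_toEuclideanLin_eq_mulVec]; rfl
  have hWW : Wᵀ * W = 1 := by
    ext i l
    have : (Wᵀ * W) i l = ⟪w i, w l⟫_ℝ := by rw [inner_toLp_eq_dotProduct]; rfl
    rw [this, one_apply]
    rcases i with i | i <;> rcases l with l | l
    · simpa [w] using hu i l
    · simpa [w] using huJ i l
    · simpa [w, real_inner_comm] using huJ l i
    · simpa [w, hJ.inner_map_map] using hu i l
  have hWW' : W * Wᵀ = 1 := mul_eq_one_comm.1 hWW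
  have hWJ : W * J (Fin (n + 1)) ℝ = J (Fin (n + 1)) ℝ * W := by
    ext i l
    have hl : (W * J (Fin (n + 1)) ℝ) i l = (W i ᵥ* J (Fin (n + 1)) ℝ) l := rfl
    rw [hmul, hl, vecMul_J, ← hj]
    rcases l with l | l
    · rfl
    · simp [W, w, hJ.map_map]
  refine ⟨W, ⟨?_, (mem_orthogonalGroup_iff' _ _).2 hWW⟩, ?_⟩
  · rw [SymplecticGroup.mem_iff, hWJ, Matrix.mul_assoc, hWW', Matrix.mul_one]
  · have hWD : Γ * W = W * diagonal (Sum.elim α β) := by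
      ext i l
      rw [hmul, mul_diagonal]
      rcases l with l | l
      · simp [w, (huT l).1, W, mul_comm]
      · simp [w, (huT l).2, W, mul_comm]
    rw [← hWD, Matrix.mul_assoc, hWW', Matrix.mul_one]

theorem exists_diagonal_form {Λ : Fin (2 * S) → ℝ} (hΛ : PureUniquePairing (S - 1) Λ)
    (hpos : ∀ i, 0 < Λ i) :
    ∃ α β : Fin S → ℝ, (∀ k, 0 < β k ∧ β k ≤ α k ∧ 1 ≤ α k * β k) ∧
      ∀ Γ : PhaseMatrix S, IsQuantumCM Γ → HasEigenspectrum Γ Λ →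
        ∃ W, IsOS W ∧ Γ = W * diagonal (Sum.elim α β) * Wᵀ := by
  cases S with
  | zero =>
    exact ⟨0, 0, fun k => k.elim0, fun Γ _ _ => ⟨1, IsOS.one, Subsingleton.elim _ _⟩⟩
  | succ n =>
    obtain ⟨α, β, hαβ, hle, hsum⟩ := exists_isNestedPairing (m := n) hΛ hpos
    exact ⟨α, β, hle, fun Γ h hΓ => h.exists_diagonalization hαβ (hΓ.trans hsum)⟩

/-- One mode with eigenvalues `α ≥ β` has thermal parameter `√(α β)` and squeezing parameter
`log (α / β) / 4`. -/
theorem hasParameters_of_diagonalization {α β : Fin S → ℝ} (hα : ∀ k, 0 < α k)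
    (hβ : ∀ k, 0 < β k) {W : PhaseMatrix S} (hW : IsOS W) :
    HasParameters (W * diagonal (Sum.elim α β) * Wᵀ)
      (fun k => Real.exp ((Real.log (α k) + Real.log (β k)) / 2))
      (fun k => (Real.log (α k) - Real.log (β k)) / 4) := by
  refine ⟨fun k => Real.exp_pos _, W, 1, hW, IsOS.one, ?_⟩
  rw [Matrix.mul_one, Matrix.transpose_mul, squeezingMatrix, thermalMatrix, diagonal_transpose]
  simp only [Matrix.mul_assoc]
  rw [← Matrix.mul_assoc (diagonal _) (diagonal _) Wᵀ, diagonal_mul_diagonal,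
    ← Matrix.mul_assoc (diagonal _) (diagonal _) Wᵀ, diagonal_mul_diagonal]
  congr 3
  ext (k | k)
  · simp only [Sum.elim_inl, ← Real.exp_add]
    rw [← Real.exp_log (hα k), Real.log_exp]
    congr 1
    ring
  · simp only [Sum.elim_inr, ← Real.exp_add]
    rw [← Real.exp_log (hβ k), Real.log_exp]
    congr 1
    ring

end Diagonalization

theorem theorem1 (S : ℕ) (Λ : Fin (2 * S) → ℝ) (hΛ : PureUniquePairing (S - 1) Λ) :
    (∀ Γ Γ' : PhaseMatrix S, IsQuantumCM Γ → IsQuantumCM Γ' →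
      HasEigenspectrum Γ Λ → HasEigenspectrum Γ' Λ → IsOSTransform Γ Γ') ∧
    (∃ ν r : Fin S → ℝ, (∀ k, 1 ≤ ν k ∧ 0 ≤ r k) ∧
      ∀ Γ : PhaseMatrix S, IsQuantumCM Γ → HasEigenspectrum Γ Λ →
        HasParameters Γ ν r ∧
        ∀ ν' r' : Fin S → ℝ, HasParameters Γ ν' r' →
          Finset.univ.val.map ν' = Finset.univ.val.map ν ∧
          Finset.univ.val.map (fun k => |r' k|) = Finset.univ.val.map r) := by
  by_cases hpos : ∀ i, 0 < Λ i
  · obtain ⟨α, β, hαβ, hdiag⟩ := exists_diagonal_form hΛ hpos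
    have hα : ∀ k, 0 < α k := fun k => (hαβ k).1.trans_le (hαβ k).2.1
    refine ⟨fun Γ Γ' h h' hΓ hΓ' => ?_, fun k => Real.exp ((Real.log (α k) + Real.log (β k)) / 2),
      fun k => (Real.log (α k) - Real.log (β k)) / 4, fun k => ⟨?_, ?_⟩, fun Γ h hΓ => ?_⟩
    · obtain ⟨W, hW, rfl⟩ := hdiag Γ h hΓ
      obtain ⟨V, hV, rfl⟩ := hdiag Γ' h' hΓ'
      refine ⟨W * V.transpose, hW.mul hV.transpose, ?_⟩
      simp only [Matrix.transpose_mul, Matrix.transpose_transpose, Matrix.mul_assoc]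
      rw [← Matrix.mul_assoc W.transpose W, hW.transpose_mul, Matrix.one_mul,
        ← Matrix.mul_assoc W.transpose W, hW.transpose_mul, Matrix.one_mul]
    · beta_reduce
      rw [← Real.log_mul (hα k).ne' (hαβ k).1.ne']
      exact Real.one_le_exp (div_nonneg (Real.log_nonneg (hαβ k).2.2) zero_le_two)
    · exact div_nonneg (sub_nonneg.2 (Real.log_le_log (hαβ k).1 (hαβ k).2.1)) zero_le_four
    · obtain ⟨W, hW, rfl⟩ := hdiag Γ h hΓ
      have hp := hasParameters_of_diagonalization hα (fun k => (hαβ k).1) hW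
      refine ⟨hp, fun ν' r' h' => ?_⟩
      obtain ⟨h1, h2⟩ := h'.unique hp
      refine ⟨h1, h2.trans (Multiset.map_congr rfl fun k _ => abs_of_nonneg ?_)⟩
      exact div_nonneg (sub_nonneg.2 (Real.log_le_log (hαβ k).1 (hαβ k).2.1)) zero_le_four
  · -- No quantum covariance matrix has a non-positive eigenvalue.
    exact ⟨fun Γ _ h _ hΓ _ => absurd (h.eigenvalue_pos hΓ) hpos, fun _ => 1, fun _ => 0,
      fun _ => ⟨le_rfl, le_rfl⟩, fun Γ h hΓ => absurd (h.eigenvalue_pos hΓ) hpos⟩
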